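/- Let $n\ge 1$ and let $B^n$ be the closed Euclidean unit ball of $\mathbb{R}^n$. A convex body is a compact convex subset of $\mathbb{R}^n$ with non-empty interior, and it is symmetric if it has a center of symmetry (not necessarily the origin). For convex bodies $K,L\subseteq\mathbb{R}^n$ let $$d_{BM}(K,L)=\inf\{\rho>0 : K+u\subseteq T(L+v)\subseteq\rho(K+u)\},$$ where the infimum is taken over all invertible linear maps $T:\mathbb{R}^n\to\mathbb{R}^n$ and all $u,v\in\mathbb{R}^n$. An ellipsoid is an image of $B^n$ under an invertible affine map of $\mathbb{R}^n$. A pair of distance ellipsoids for a symmetric convex body $K$ is a pair $(E_1,E_2)$ of ellipsoids with $E_1\subseteq K\subseteq E_2$ and $E_2=d_{BM}(K,B^n)\,E_1+w$ for some $w\in\mathbb{R}^n$; the ellipsoids may be centered anywhere and need not be concentric. The John ellipsoid of $K$ is the unique ellipsoid of maximal volume contained in $K$, and the Loewner ellipsoid of $K$ is the unique ellipsoid of minimal volume containing $K$. Let $K\subseteq\mathbb{R}^n$ be a symmetric convex body. If $d_{BM}(K,B^n)>\sqrt{n-1}$, then $K$ has exactly one pair of distance ellipsoids. If $d_{BM}(K,B^n)=\sqrt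 n$, then this unique pair $(E_1,E_2)$ consists of the John ellipsoid $E_1$ and the Loewner ellipsoid $E_2$ of $K$. In particular, every symmetric convex body in $\mathbb{R}^2$ has exactly one pair of distance ellipsoids. -/

import Mathlib

open MeasureTheory
open scoped Pointwise

/-- A convex body in `ℝⁿ`: a compact, convex set with non-empty interior. -/
structure IsConvexBody {n : ℕ} (K : Set (EuclideanSpace ℝ (Fin n))) : Prop where
  isCompact : IsCompact K
  convex : Convex ℝ K
  interior_nonempty : (interior K).Nonempty

/-- A symmetric convex body: a convex body that has a (not necessarily zero) center of symmetry
`c`, i.e. it is invariant under the point reflection `x ↦ 2c - x`. -/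
def IsSymmetricConvexBody {n : ℕ} (K : Set (EuclideanSpace ℝ (Fin n))) : Prop :=
  IsConvexBody K ∧ ∃ c : EuclideanSpace ℝ (Fin n), ∀ x ∈ K, (2 : ℝ) • c - x ∈ K

/-- The closed Euclidean unit ball of `ℝⁿ`. -/
def unitBall (n : ℕ) : Set (EuclideanSpace ℝ (Fin n)) :=
  Metric.closedBall 0 1

/-- The Banach-Mazur distance
`d(K, L) = inf {ρ > 0 : K + u ⊆ T (L + v) ⊆ ρ (K + u)}`,
the infimum being over all invertible linear `T` and all vectors `u`, `v`. -/
noncomputable def banachMazurDist {n : ℕ} (K L : Set (EuclideanSpace ℝ (Fin n))) : ℝ :=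
  sInf {ρ : ℝ | 0 < ρ ∧
    ∃ (T : EuclideanSpace ℝ (Fin n) ≃ₗ[ℝ] EuclideanSpace ℝ (Fin n))
      (u v : EuclideanSpace ℝ (Fin n)),
      u +ᵥ K ⊆ T '' (v +ᵥ L) ∧ T '' (v +ᵥ L) ⊆ ρ • (u +ᵥ K)}

/-- A (non-degenerate, arbitrarily centered) ellipsoid: the image of the closed Euclidean unit
ball under an invertible affine map. -/
def IsEllipsoid {n : ℕ} (E : Set (EuclideanSpace ℝ (Fin n))) : Prop :=
  ∃ T : EuclideanSpace ℝ (Fin n) ≃ᵃ[ℝ] EuclideanSpace ℝ (Fin n), E = T '' unitBall n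

/-- `(E₁, E₂)` is a pair of distance ellipsoids for `K`: ellipsoids with `E₁ ⊆ K ⊆ E₂` such that
`E₂` is a translate of `d • E₁`, where `d` is the Banach-Mazur distance of `K` to the Euclidean
ball. No condition is put on the centers of `E₁`, `E₂`. -/
structure IsDistanceEllipsoidPair {n : ℕ} (K E₁ E₂ : Set (EuclideanSpace ℝ (Fin n))) : Prop where
  isEllipsoid_inner : IsEllipsoid E₁
  isEllipsoid_outer : IsEllipsoid E₂
  homothetic : ∃ v : EuclideanSpace ℝ (Fin n),
    E₂ = v +ᵥ (banachMazurDist K (unitBall n) • E₁)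
  inner_subset : E₁ ⊆ K
  subset_outer : K ⊆ E₂

/-- `K` has exactly one pair of distance ellipsoids. -/
def HasUniqueDistanceEllipsoidPair {n : ℕ} (K : Set (EuclideanSpace ℝ (Fin n))) : Prop :=
  ∃! E : Set (EuclideanSpace ℝ (Fin n)) × Set (EuclideanSpace ℝ (Fin n)),
    IsDistanceEllipsoidPair K E.1 E.2

/-- `E` is the John ellipsoid of `K`: the unique ellipsoid of maximal volume contained in `K`. -/
structure IsJohnEllipsoid {n : ℕ} (K E : Set (EuclideanSpace ℝ (Fin n))) : Prop where
  isEllipsoid : IsEllipsoid E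
  subset : E ⊆ K
  volume_lt : ∀ F : Set (EuclideanSpace ℝ (Fin n)), IsEllipsoid F → F ⊆ K → F ≠ E →
    volume F < volume E

/-- `E` is the Loewner ellipsoid of `K`: the unique ellipsoid of minimal volume containing `K`. -/
structure IsLoewnerEllipsoid {n : ℕ} (K E : Set (EuclideanSpace ℝ (Fin n))) : Prop where
  isEllipsoid : IsEllipsoid E
  subset : K ⊆ E
  lt_volume : ∀ F : Set (EuclideanSpace ℝ (Fin n)), IsEllipsoid F → K ⊆ F → F ≠ E →
    volume E < volume F

/-! Compactness gives an optimal pair of homothetic ellipsoids centred at the centre of symmetry; an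
affine map turns it into `B ⊆ K ⊆ dB`. Call a unit vector `u` an inner contact if `⟪x, u⟫ ≤ 1` on
`K`, and `v` an outer contact if `d v ∈ K`.

First-order optimality: the closed convex hulls of `u ⊗ u` over inner and over outer contacts meet.
Otherwise a separating symmetric form `H` makes `1 + tH` a strictly better sandwich for small `t >
0`. A common matrix `M` has trace 1, and symmetry of `K` gives `⟪u, v⟫² ≤ 1 / d²`, hence `⟪M, M⟫ ≤ 1
/ d²` (`exists_certificate`). If some `w ≠ 0` were orthogonal to all contacts of one kind, `M` would
live on `wᗮ`, and Cauchy–Schwarz would give `d² ≤ n - 1`. So for `d > √(n - 1)` either kind of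
contact spans.

Uniqueness (`norm_map_eq`): by polar decomposition a second optimal pair comes from a positive `S`.
The mean `(1 + S) / 2` is again optimal, and equality in its outer estimate forces `S` to fix its
outer contacts. These span, so `S = 1`. The contacts also fix both centres.

If `d² = n`, Cauchy–Schwarz is an equality and `M = 1 / n`: John's decomposition of the identity,
which bounds traces and, by AM-GM, determinants. In the plane `√(n - 1) = 1`, and `d ≤ 1` means that
`K` is an ellipsoid. -/

/-! ### Positive operators: polar decomposition, determinant and mean inequalities. -/

section LinearAlgebra

variable {E : Type*} [NormedAddCommGroup E] [InnerProductSpace ℝ E] [FiniteDimensional ℝ E]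

/-- A positive operator on a finite-dimensional space has a positive square root. -/
theorem LinearMap.IsPositive.exists_sq_eq {P : E →ₗ[ℝ] E} (hP : P.IsPositive) :
    ∃ S : E →ₗ[ℝ] E, S.IsPositive ∧ ∀ x, S (S x) = P x := by
  classical
  let b := hP.isSymmetric.eigenvectorBasis rfl
  let l := hP.isSymmetric.eigenvalues rfl
  let S : E →ₗ[ℝ] E :=
    ∑ i, Real.sqrt (l i) • (InnerProductSpace.rankOne ℝ (b i) (b i)).toLinearMap
  have hSb : ∀ i, S (b i) = Real.sqrt (l i) • b i := by
    intro i
    simp only [S, LinearMap.sum_apply, LinearMap.smul_apply, ContinuousLinearMap.coe_coe,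
      InnerProductSpace.rankOne_apply]
    rw [Finset.sum_eq_single i]
    · simp
    · intro j _ hj
      rw [b.inner_eq_zero hj]; simp
    · simp
  refine ⟨S, LinearMap.isPositive_sum _ fun i _ => LinearMap.IsPositive.smul_of_nonneg ?_
    (Real.sqrt_nonneg _), ?_⟩
  · exact (ContinuousLinearMap.isPositive_toLinearMap_iff _).2
      (InnerProductSpace.isPositive_rankOne_self _)
  · have : S ∘ₗ S = P := by
      refine b.toBasis.ext fun i => ?_
      have h0 : 0 ≤ l i := hP.nonneg_eigenvalues rfl i
      rw [OrthonormalBasis.coe_toBasis, LinearMap.comp_apply, hSb, map_smul, hSb, smul_smul,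
        Real.mul_self_sqrt h0]
      exact (hP.isSymmetric.apply_eigenvectorBasis rfl i).symm
    exact fun x => congrArg (fun f : E →ₗ[ℝ] E => f x) this

/-- Left polar decomposition of an invertible operator. -/
theorem LinearEquiv.exists_polar (A : E ≃ₗ[ℝ] E) :
    ∃ (S : E ≃ₗ[ℝ] E) (U : E ≃ₗᵢ[ℝ] E), S.toLinearMap.IsPositive ∧ ∀ x, A x = S (U x) := by
  let P : E →ₗ[ℝ] E := A.toLinearMap ∘ₗ A.toLinearMap.adjoint
  have hP : P.IsPositive := LinearMap.isPositive_self_comp_adjoint _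
  obtain ⟨S, hS, hSS⟩ := hP.exists_sq_eq
  have hadj : ∀ y, A.toLinearMap.adjoint y = 0 → y = 0 := by
    intro y hy
    have h := LinearMap.adjoint_inner_left A.toLinearMap (A.symm y) y
    rw [hy, inner_zero_left] at h
    simpa using h.symm
  have hinj : Function.Injective S := by
    rw [injective_iff_map_eq_zero]
    intro y hy
    have h := hSS y
    rw [hy, map_zero] at h
    exact hadj y (A.map_eq_zero_iff.1 h.symm)
  let S' : E ≃ₗ[ℝ] E := LinearEquiv.ofInjectiveEndo S hinj
  have hS' : ∀ x, S' x = S x := fun x => rfl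
  refine ⟨S', ⟨A.trans S'.symm, fun x => ?_⟩, hS, fun x => ?_⟩
  -- Here `U = S⁻¹A` and `w = S⁻²Ax`. As `S² = AA*`, injectivity of `A` gives `A*w = x`, whence
  -- `‖Ux‖² = ⟪w, Ax⟫ = ‖x‖²`.
  · set u := S'.symm (A x) with hu
    set w := S'.symm u with hw
    have h1 : S u = A x := by rw [← hS', hu, LinearEquiv.apply_symm_apply]
    have h2 : S w = u := by rw [← hS', hw, LinearEquiv.apply_symm_apply]
    have h3 : A.toLinearMap.adjoint w = x := by
      apply A.injective
      have := hSS w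
      rw [h2, h1] at this
      exact this.symm
    have h4 : inner ℝ u u = inner ℝ x x := by
      calc inner ℝ u u = inner ℝ (S w) u := by rw [h2]
        _ = inner ℝ w (A x) := by rw [hS.isSymmetric, h1]
        _ = inner ℝ x x := by
          rw [← h3]
          have := LinearMap.adjoint_inner_left A.toLinearMap x w
          rw [h3] at this ⊢
          exact this.symm
    rw [real_inner_self_eq_norm_sq, real_inner_self_eq_norm_sq] at h4
    exact (sq_eq_sq₀ (norm_nonneg _) (norm_nonneg _)).1 h4
  · change A x = S' (S'.symm (A x))
    simp

/-- Among positive invertible operators of trace at most the dimension, the identity is the only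
one whose determinant is at least one. -/
theorem LinearMap.IsPositive.det_lt_one {S : E ≃ₗ[ℝ] E} (hS : S.toLinearMap.IsPositive)
    (htr : LinearMap.trace ℝ E S.toLinearMap ≤ Module.finrank ℝ E)
    (hne : S ≠ LinearEquiv.refl ℝ E) : LinearMap.det S.toLinearMap < 1 := by
  have hsym := hS.isSymmetric
  set l := hsym.eigenvalues rfl with hl
  let b := hsym.eigenvectorBasis rfl
  have hb : ∀ i, S (b i) = l i • b i := fun i => hsym.apply_eigenvectorBasis rfl i
  have hpos : ∀ i, 0 < l i := by
    intro i
    refine lt_of_le_of_ne (hS.nonneg_eigenvalues rfl i) fun h => ?_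
    have h1 := hb i
    rw [← h, zero_smul, LinearEquiv.map_eq_zero_iff] at h1
    exact b.orthonormal.ne_zero i h1
  obtain ⟨i, hi⟩ : ∃ i, l i ≠ 1 := by
    by_contra! h
    refine hne (LinearEquiv.toLinearMap_injective (b.toBasis.ext fun i => ?_))
    have := hb i
    rw [h i, one_smul] at this
    simpa using this
  have hdet : LinearMap.det S.toLinearMap = ∏ i, l i := by
    have := hsym.det_eq_prod_eigenvalues rfl
    simpa using this
  have htrace : LinearMap.trace ℝ E S.toLinearMap = ∑ i, l i := by
    have := hsym.trace_eq_sum_eigenvalues rfl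
    simpa using this
  rw [hdet]
  -- AM-GM through `t ≤ exp (t - 1)`, strict for `t ≠ 1`.
  calc ∏ i, l i < ∏ i, Real.exp (l i - 1) := by
        refine Finset.prod_lt_prod (fun j _ => hpos j) (fun j _ => ?_) ⟨i, Finset.mem_univ _, ?_⟩
        · simpa using Real.add_one_le_exp (l j - 1)
        · simpa using Real.add_one_lt_exp (sub_ne_zero.2 hi)
    _ = Real.exp (∑ i, l i - Module.finrank ℝ E) := by
        rw [← Real.exp_sum, Finset.sum_sub_distrib]; simp
    _ ≤ 1 := by rw [← htrace]; exact Real.exp_le_one_iff.2 (by linarith)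

/-- If `z` solves `(1 + S) z = 2 S w` for a positive operator `S`, then `‖z‖² ≤ ⟪S w, w⟫`. -/
theorem LinearMap.IsPositive.norm_sq_le_inner {S : E →ₗ[ℝ] E} (hS : S.IsPositive) {z w : E}
    (h : z + S z = (2 : ℝ) • S w) : ‖z‖ ^ 2 ≤ inner ℝ (S w) w := by
  have hinj : Function.Injective (LinearMap.id + S : E →ₗ[ℝ] E) := by
    rw [injective_iff_map_eq_zero]
    intro y hy
    have h1 : inner ℝ (y + S y) y = (0 : ℝ) := by
      have : y + S y = 0 := hy
      rw [this, inner_zero_left]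
    rw [inner_add_left, real_inner_self_eq_norm_sq] at h1
    have h2 := hS.inner_nonneg_left y
    have : ‖y‖ ^ 2 = 0 := by nlinarith [sq_nonneg ‖y‖]
    simpa using this
  obtain ⟨g, hg⟩ := (LinearMap.injective_iff_surjective.1 hinj) w
  replace hg : g + S g = w := hg
  have hz : z = (2 : ℝ) • S g := by
    apply hinj
    change z + S z = (2 : ℝ) • S g + S ((2 : ℝ) • S g)
    rw [h, ← hg, map_add, map_smul, smul_add]
  -- With `w = g + S g` and `z = 2 S g`, the difference of the two sides is exactly `⟪S (g - S g), g
  -- - S g⟫`.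
  have hpos := hS.inner_nonneg_left (g - S g)
  have hs := hS.isSymmetric
  have e1 := hs (S g) g
  rw [hz, norm_smul, mul_pow, ← hg, map_add, ← real_inner_self_eq_norm_sq]
  rw [map_sub] at hpos
  simp only [inner_add_left, inner_add_right, inner_sub_left, inner_sub_right] at hpos ⊢
  norm_num
  rw [real_inner_self_eq_norm_sq] at e1 hpos
  linarith

end LinearAlgebra

/-! ### Quadratic forms as linear functionals on matrices. -/

section TensorSquare

variable {n : ℕ}

/-- The tensor square `u ⊗ u`, as a vector of matrix entries. -/
noncomputable def tensorSq (u : EuclideanSpace ℝ (Fin n)) : EuclideanSpace ℝ (Fin n × Fin n) :=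
  WithLp.toLp 2 fun p => u p.1 * u p.2

/-- The vector of matrix entries of an operator. -/
noncomputable def entries (A : EuclideanSpace ℝ (Fin n) →ₗ[ℝ] EuclideanSpace ℝ (Fin n)) :
    EuclideanSpace ℝ (Fin n × Fin n) :=
  WithLp.toLp 2 fun p => A (EuclideanSpace.single p.2 1) p.1

theorem inner_entries_tensorSq (A : EuclideanSpace ℝ (Fin n) →ₗ[ℝ] EuclideanSpace ℝ (Fin n))
    (u : EuclideanSpace ℝ (Fin n)) : inner ℝ (entries A) (tensorSq u) = inner ℝ u (A u) := by
  have hu : u = ∑ j, u j • EuclideanSpace.single j (1 : ℝ) := by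
    ext i
    simp [Finset.sum_apply, Pi.single_apply]
  have hA : A u = ∑ j, u j • A (EuclideanSpace.single j (1 : ℝ)) := by
    conv_lhs => rw [hu]
    simp
  rw [hA]
  simp only [entries, tensorSq, PiLp.inner_apply, RCLike.inner_apply, conj_trivial,
    Fintype.sum_prod_type, WithLp.ofLp_sum, Finset.sum_apply, PiLp.smul_apply, smul_eq_mul,
    Finset.sum_mul]
  refine Finset.sum_congr rfl fun i _ => Finset.sum_congr rfl fun j _ => ?_
  ring

theorem inner_tensorSq (u v : EuclideanSpace ℝ (Fin n)) :
    inner ℝ (tensorSq u) (tensorSq v) = (inner ℝ u v : ℝ) ^ 2 := by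
  simp only [tensorSq, PiLp.inner_apply, RCLike.inner_apply, conj_trivial, Fintype.sum_prod_type,
    sq, Finset.sum_mul_sum]
  refine Finset.sum_congr rfl fun i _ => Finset.sum_congr rfl fun j _ => ?_
  ring

theorem inner_entries_id (A : EuclideanSpace ℝ (Fin n) →ₗ[ℝ] EuclideanSpace ℝ (Fin n)) :
    inner ℝ (entries A) (entries LinearMap.id) = LinearMap.trace ℝ _ A := by
  rw [LinearMap.trace_eq_sum_inner A (EuclideanSpace.basisFun (Fin n) ℝ)]
  simp only [entries, PiLp.inner_apply, RCLike.inner_apply, conj_trivial, Fintype.sum_prod_type]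
  simp

/-- Every linear functional on matrices restricts on squares to a symmetric quadratic form. -/
theorem exists_isSymmetric_inner_tensorSq (G : EuclideanSpace ℝ (Fin n × Fin n)) :
    ∃ H : EuclideanSpace ℝ (Fin n) →ₗ[ℝ] EuclideanSpace ℝ (Fin n), H.IsSymmetric ∧
      ∀ u, inner ℝ G (tensorSq u) = inner ℝ u (H u) := by
  let A : EuclideanSpace ℝ (Fin n) →ₗ[ℝ] EuclideanSpace ℝ (Fin n) :=
    Matrix.toEuclideanLin (Matrix.of fun i j => G (i, j))
  have hA : entries A = G := by
    ext p
    simp [entries, A, Matrix.toLpLin_apply, Matrix.mulVec_single]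
  refine ⟨(1 / 2 : ℝ) • (A + A.adjoint), ?_, fun u => ?_⟩
  · intro x y
    simp only [LinearMap.smul_apply, LinearMap.add_apply, inner_smul_left, inner_smul_right,
      inner_add_left, inner_add_right, LinearMap.adjoint_inner_left, LinearMap.adjoint_inner_right]
    simp [add_comm]
  · rw [← hA, inner_entries_tensorSq]
    simp only [LinearMap.smul_apply, LinearMap.add_apply, inner_smul_right, inner_add_right,
      LinearMap.adjoint_inner_right]
    rw [real_inner_comm u (A u)]
    ring

theorem inner_le_of_mem_closedConvexHull {V : Type*} [NormedAddCommGroup V] [InnerProductSpace ℝ V]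
    {s : Set V} {G M : V} {c : ℝ} (h : ∀ x ∈ s, inner ℝ G x ≤ c)
    (hM : M ∈ closedConvexHull ℝ s) : inner ℝ G M ≤ c := by
  refine closedConvexHull_min (t := {x | inner ℝ G x ≤ c}) h ?_ ?_ hM
  · exact convex_halfSpace_le (innerₛₗ ℝ G).isLinear c
  · exact isClosed_le (by fun_prop) continuous_const

theorem le_inner_of_mem_closedConvexHull {V : Type*} [NormedAddCommGroup V] [InnerProductSpace ℝ V]
    {s : Set V} {G M : V} {c : ℝ} (h : ∀ x ∈ s, c ≤ inner ℝ G x)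
    (hM : M ∈ closedConvexHull ℝ s) : c ≤ inner ℝ G M := by
  have := inner_le_of_mem_closedConvexHull (G := -G) (c := -c)
    (fun x hx => by rw [inner_neg_left]; linarith [h x hx]) hM
  rw [inner_neg_left] at this
  linarith

theorem inner_eq_of_mem_closedConvexHull {V : Type*} [NormedAddCommGroup V] [InnerProductSpace ℝ V]
    {s : Set V} {G M : V} {c : ℝ} (h : ∀ x ∈ s, inner ℝ G x = c)
    (hM : M ∈ closedConvexHull ℝ s) : inner ℝ G M = c :=
  le_antisymm (inner_le_of_mem_closedConvexHull (fun x hx => (h x hx).le) hM)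
    (le_inner_of_mem_closedConvexHull (fun x hx => (h x hx).ge) hM)

end TensorSquare

/-! ### Contact directions and first-order optimality. -/

section Contact

variable {n : ℕ}

/-- `K` is a compact convex set symmetric about the origin, and no sandwich of `K` between
homothetic origin-centered ellipsoids has a ratio smaller than `d`. -/
structure IsSandwichBound (K : Set (EuclideanSpace ℝ (Fin n))) (d : ℝ) : Prop where
  isCompact : IsCompact K
  convex : Convex ℝ K
  neg_mem : ∀ x ∈ K, -x ∈ K
  pos : 0 < d
  le_of_sandwich : ∀ (T : EuclideanSpace ℝ (Fin n) ≃ₗ[ℝ] EuclideanSpace ℝ (Fin n)) (ρ : ℝ),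
    0 < ρ → (∀ b, ‖b‖ ≤ 1 → T b ∈ K) → (∀ x ∈ K, ‖T.symm x‖ ≤ ρ) → d ≤ ρ

/-- The unit ball and its `d`-fold multiple form a sandwich of `K` of smallest ratio. -/
structure IsDistancePosition (K : Set (EuclideanSpace ℝ (Fin n))) (d : ℝ) : Prop extends
    IsSandwichBound K d where
  mem_of_norm_le : ∀ x, ‖x‖ ≤ 1 → x ∈ K
  norm_le : ∀ x ∈ K, ‖x‖ ≤ d

/-- Directions in which the unit ball touches the boundary of `K` from inside. -/
def innerContact (K : Set (EuclideanSpace ℝ (Fin n))) : Set (EuclideanSpace ℝ (Fin n)) :=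
  {u | ‖u‖ = 1 ∧ ∀ x ∈ K, inner ℝ x u ≤ (1 : ℝ)}

/-- Directions in which `K` reaches the sphere of radius `d`. -/
def outerContact (K : Set (EuclideanSpace ℝ (Fin n))) (d : ℝ) : Set (EuclideanSpace ℝ (Fin n)) :=
  {v | ‖v‖ = 1 ∧ d • v ∈ K}

namespace IsDistancePosition

variable {K : Set (EuclideanSpace ℝ (Fin n))} {d : ℝ}

/-- No infinitesimal deformation of the unit ball moves it off `K` at all inner contacts while
moving the outer ball closer to `K` at all outer contacts. -/
theorem not_forall_contact (h : IsDistancePosition K d)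
    {H : EuclideanSpace ℝ (Fin n) →ₗ[ℝ] EuclideanSpace ℝ (Fin n)} (hH : H.IsSymmetric)
    (hin : ∀ u ∈ innerContact K, inner ℝ u (H u) < (0 : ℝ))
    (hout : ∀ v ∈ outerContact K d, (0 : ℝ) < inner ℝ v (H v)) : False := by
  have hHc : Continuous H := H.continuous_of_finiteDimensional
  have hz : (0 : EuclideanSpace ℝ (Fin n)) ∈ K := h.mem_of_norm_le 0 (by simp)
  have hexp : ∀ (t : ℝ) y, ‖y + t • H y‖ ^ 2 =
      ‖y‖ ^ 2 + t * (2 * inner ℝ y (H y) + t * ‖H y‖ ^ 2) := by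
    intro t y
    rw [norm_add_sq_real, inner_smul_right, norm_smul, mul_pow, Real.norm_eq_abs, sq_abs]
    ring
  -- `‖y + tHy‖` is the support function of `(1 + tH)B` at `y`; it must not exceed that of `K`. At
  -- contacts the first-order term is negative, elsewhere there is slack; compactness makes `t`
  -- uniform.
  have ev1 : ∀ᶠ t : ℝ in nhds 0, ∀ y ∈ Metric.sphere (0 : EuclideanSpace ℝ (Fin n)) 1,
      ‖y‖ = 1 → 0 < t → ∃ x ∈ K, ‖y + t • H y‖ ≤ inner ℝ x y := by
    refine (isCompact_sphere _ _).eventually_forall_of_forall_eventually fun y hy => ?_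
    rw [mem_sphere_zero_iff_norm] at hy
    by_cases hc : ∀ x ∈ K, inner ℝ x y ≤ (1 : ℝ)
    · have hlt := hin y ⟨hy, hc⟩
      have hev : ∀ᶠ z : ℝ × EuclideanSpace ℝ (Fin n) in nhds (0, y),
          2 * inner ℝ z.2 (H z.2) + z.1 * ‖H z.2‖ ^ 2 < 0 := by
        refine ContinuousAt.eventually_lt (Continuous.continuousAt (by fun_prop))
          continuousAt_const ?_
        simpa only [zero_mul, add_zero] using mul_neg_of_pos_of_neg two_pos hlt
      filter_upwards [hev] with z hz1 hz2 hz0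
      refine ⟨z.2, h.mem_of_norm_le _ hz2.le, ?_⟩
      rw [real_inner_self_eq_norm_sq, hz2, one_pow]
      have h1 := hexp z.1 z.2
      have h2 := mul_neg_of_pos_of_neg hz0 hz1
      rw [hz2] at h1
      exact abs_le_one_iff_mul_self_le_one.2 (by nlinarith) |>.trans' (le_abs_self _)
    · push Not at hc
      obtain ⟨x, hx, hxy⟩ := hc
      have hev : ∀ᶠ z : ℝ × EuclideanSpace ℝ (Fin n) in nhds (0, y),
          ‖z.2 + z.1 • H z.2‖ < inner ℝ x z.2 := by
        refine ContinuousAt.eventually_lt (Continuous.continuousAt (by fun_prop))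
          (Continuous.continuousAt (by fun_prop)) ?_
        simpa [hy] using hxy
      filter_upwards [hev] with z hz1 _ _
      exact ⟨x, hx, hz1.le⟩
  -- Likewise `1 + tH` pushes the sphere of radius `d` off `K`.
  have ev2 : ∀ᶠ t : ℝ in nhds 0, ∀ z ∈ Metric.sphere (0 : EuclideanSpace ℝ (Fin n)) d,
      ‖z‖ = d → 0 < t → z + t • H z ∉ K := by
    refine (isCompact_sphere _ _).eventually_forall_of_forall_eventually fun z₀ hz₀ => ?_
    rw [mem_sphere_zero_iff_norm] at hz₀
    by_cases hc : z₀ ∈ K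
    · have hgt := hout (d⁻¹ • z₀) ⟨by
          rw [norm_smul, norm_inv, Real.norm_of_nonneg h.pos.le, hz₀, inv_mul_cancel₀ h.pos.ne'],
        by rwa [smul_inv_smul₀ h.pos.ne']⟩
      have hgt' : 0 < inner ℝ z₀ (H z₀) := by
        rw [map_smul, inner_smul_left, inner_smul_right, ← mul_assoc] at hgt
        exact (mul_pos_iff_of_pos_left (by have := h.pos; simp; positivity)).1 hgt
      have hev : ∀ᶠ z : ℝ × EuclideanSpace ℝ (Fin n) in nhds (0, z₀),
          0 < 2 * inner ℝ z.2 (H z.2) + z.1 * ‖H z.2‖ ^ 2 := by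
        refine ContinuousAt.eventually_lt continuousAt_const
          (Continuous.continuousAt (by fun_prop)) ?_
        simpa using hgt'
      filter_upwards [hev] with z hz1 hz2 hz0 hmem
      have h1 := hexp z.1 z.2
      have h2 := mul_pos hz0 hz1
      have h3 := pow_le_pow_left₀ (norm_nonneg _) (h.norm_le _ hmem) 2
      rw [hz2] at h1
      linarith
    · have hev : ∀ᶠ z : ℝ × EuclideanSpace ℝ (Fin n) in nhds (0, z₀),
          z.2 + z.1 • H z.2 ∈ Kᶜ := by
        have hcont : Continuous fun z : ℝ × EuclideanSpace ℝ (Fin n) => z.2 + z.1 • H z.2 := by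
          fun_prop
        exact hcont.continuousAt.eventually_mem
          (h.isCompact.isClosed.isOpen_compl.mem_nhds (by simpa using hc))
      filter_upwards [hev] with z hz1 _ _
      exact hz1
  obtain ⟨t, ht0, ht1, ht2⟩ : ∃ t : ℝ, 0 < t ∧
      (∀ y, ‖y‖ = 1 → ∃ x ∈ K, ‖y + t • H y‖ ≤ inner ℝ x y) ∧
      ∀ z, ‖z‖ = d → z + t • H z ∉ K := by
    have := ((ev1.and ev2).filter_mono (nhdsWithin_le_nhds (s := Set.Ioi 0))).and
      self_mem_nhdsWithin
    obtain ⟨t, ⟨h1, h2⟩, h3⟩ := this.exists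
    exact ⟨t, h3, fun y hy => h1 y (by simpa using hy) hy h3,
      fun z hz => h2 z (by simpa using hz) hz h3⟩
  let T₀ : EuclideanSpace ℝ (Fin n) →ₗ[ℝ] EuclideanSpace ℝ (Fin n) := LinearMap.id + t • H
  have hT₀ : ∀ y, T₀ y = y + t • H y := fun y => rfl
  have hsym : T₀.IsSymmetric := LinearMap.IsSymmetric.id.add (hH.smul (by simp))
  have hinner : ∀ b, ‖b‖ ≤ 1 → T₀ b ∈ K := by
    intro b hb
    by_contra hnot
    obtain ⟨f, s, hf1, hf2⟩ := geometric_hahn_banach_closed_point h.convex h.isCompact.isClosed hnot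
    set y := (InnerProductSpace.toDual ℝ _).symm f with hy
    have hfy : ∀ x, f x = inner ℝ y x := fun x => by simp [hy]
    have hs : 0 < s := by simpa using hf1 0 hz
    have hy0 : y ≠ 0 := by
      intro h0
      rw [hfy, h0, inner_zero_left] at hf2
      linarith
    have hy0' : 0 < ‖y‖ := norm_pos_iff.2 hy0
    obtain ⟨x, hx, hxy⟩ := ht1 (‖y‖⁻¹ • y) (norm_smul_inv_norm hy0)
    rw [← hT₀, map_smul, norm_smul, inner_smul_right, norm_inv, norm_norm,
      mul_le_mul_iff_right₀ (inv_pos.2 hy0')] at hxy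
    have h1 := hf1 x hx
    rw [hfy] at h1 hf2
    rw [← hsym] at hf2
    have h2 := real_inner_le_norm (T₀ y) b
    have h3 : ‖T₀ y‖ * ‖b‖ ≤ ‖T₀ y‖ := mul_le_of_le_one_right (norm_nonneg _) hb
    rw [real_inner_comm] at hxy
    linarith
  have houter : ∀ z, T₀ z ∈ K → ‖z‖ < d := by
    intro z hzK
    by_contra! hle
    have hzpos : 0 < ‖z‖ := h.pos.trans_le hle
    refine ht2 ((d / ‖z‖) • z) ?_ ?_
    · rw [norm_smul, Real.norm_of_nonneg (div_nonneg h.pos.le hzpos.le),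
        div_mul_cancel₀ _ hzpos.ne']
    · rw [← hT₀, map_smul]
      exact h.convex.smul_mem_of_zero_mem hz hzK
        ⟨div_nonneg h.pos.le hzpos.le, (div_le_one hzpos).2 hle⟩
  have hinj : Function.Injective T₀ := by
    rw [injective_iff_map_eq_zero]
    intro y hy
    by_contra hy0
    have hypos : 0 < ‖y‖ := norm_pos_iff.2 hy0
    have := houter ((d / ‖y‖) • y) (by rw [map_smul, hy, smul_zero]; exact hz)
    rw [norm_smul, Real.norm_of_nonneg (div_nonneg h.pos.le hypos.le),
      div_mul_cancel₀ _ hypos.ne'] at this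
    exact lt_irrefl _ this
  let T := LinearEquiv.ofInjectiveEndo T₀ hinj
  have hTT : ∀ x, T₀ (T.symm x) = x := fun x => T.apply_symm_apply x
  have hcont : Continuous fun x => ‖T.symm x‖ :=
    (T.symm.toLinearMap.continuous_of_finiteDimensional).norm
  obtain ⟨x, hxK, hmax⟩ := h.isCompact.exists_isMaxOn ⟨0, hz⟩ hcont.continuousOn
  have hlt := houter (T.symm x) (by rwa [hTT])
  -- The attained maximum is below `d`; `d / 2` only keeps the ratio positive.
  have := h.le_of_sandwich T (max ‖T.symm x‖ (d / 2)) (lt_max_of_lt_right (half_pos h.pos))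
    hinner fun w hw => le_max_of_le_left (hmax hw)
  rcases le_max_iff.1 this with h1 | h1
  · linarith
  · linarith [h.pos]

/-- Optimality certificate: some matrix is a limit of convex combinations of `u ⊗ u` both over
the inner and over the outer contact directions. -/
theorem exists_mem_closedConvexHull (h : IsDistancePosition K d) :
    ∃ M, M ∈ closedConvexHull ℝ (tensorSq '' innerContact K) ∧
      M ∈ closedConvexHull ℝ (tensorSq '' outerContact K d) := by
  by_contra! hdis
  have hbdd : ∀ s : Set (EuclideanSpace ℝ (Fin n)), (∀ u ∈ s, ‖u‖ = 1) →
      Bornology.IsBounded (closedConvexHull ℝ (tensorSq '' s)) := by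
    intro s hs
    rw [closedConvexHull_eq_closure_convexHull]
    refine Bornology.IsBounded.closure ((isBounded_convexHull).2 ?_)
    refine (isBounded_iff_forall_norm_le).2 ⟨1, ?_⟩
    rintro _ ⟨u, hu, rfl⟩
    have : ‖tensorSq u‖ ^ 2 = 1 := by
      rw [← real_inner_self_eq_norm_sq, inner_tensorSq, real_inner_self_eq_norm_sq, hs u hu]
      norm_num
    nlinarith [norm_nonneg (tensorSq u)]
  obtain ⟨f, a, b, hf1, hab, hf2⟩ := geometric_hahn_banach_compact_closed
    (convex_closedConvexHull (𝕜 := ℝ) (s := tensorSq '' innerContact K))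
    (Metric.isCompact_of_isClosed_isBounded isClosed_closedConvexHull
      (hbdd _ fun u hu => hu.1))
    (convex_closedConvexHull (𝕜 := ℝ) (s := tensorSq '' outerContact K d))
    isClosed_closedConvexHull (Set.disjoint_left.2 hdis)
  set G := (InnerProductSpace.toDual ℝ _).symm f with hG
  have hfG : ∀ x, f x = inner ℝ G x := fun x => by simp [hG]
  obtain ⟨H, hH, hHG⟩ := exists_isSymmetric_inner_tensorSq G
  -- On unit vectors, subtracting `a • id` moves the separation level to zero.
  let F : EuclideanSpace ℝ (Fin n) →ₗ[ℝ] EuclideanSpace ℝ (Fin n) := H - a • LinearMap.id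
  have hsub : F.IsSymmetric :=
    hH.sub (LinearMap.IsSymmetric.id.smul (by simp))
  have key : ∀ u : EuclideanSpace ℝ (Fin n), ‖u‖ = 1 →
      inner ℝ u (F u) = f (tensorSq u) - a := by
    intro u hu
    rw [hfG, hHG, show F u = H u - a • u from rfl, inner_sub_right, inner_smul_right,
      real_inner_self_eq_norm_sq, hu]
    ring
  refine h.not_forall_contact hsub (fun u hu => ?_) fun v hv => ?_
  · rw [key u hu.1]
    linarith [hf1 _ (subset_closedConvexHull (Set.mem_image_of_mem tensorSq hu))]
  · rw [key v hv.1]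
    linarith [hf2 _ (subset_closedConvexHull (Set.mem_image_of_mem tensorSq hv))]

end IsDistancePosition

end Contact

/-- Left polar decomposition of an invertible operator, with the determinant of the positive
factor. -/
theorem LinearEquiv.exists_polar_abs_det {E : Type*} [NormedAddCommGroup E]
    [InnerProductSpace ℝ E] [FiniteDimensional ℝ E] (A : E ≃ₗ[ℝ] E) :
    ∃ (S : E ≃ₗ[ℝ] E) (U : E ≃ₗᵢ[ℝ] E), S.toLinearMap.IsPositive ∧ (∀ x, A x = S (U x)) ∧
      |LinearMap.det A.toLinearMap| = LinearMap.det S.toLinearMap := by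
  obtain ⟨S, U, hS, hSU⟩ := A.exists_polar
  refine ⟨S, U, hS, hSU, ?_⟩
  have h1 : A.toLinearMap = S.toLinearMap ∘ₗ U.toLinearEquiv.toLinearMap := LinearMap.ext hSU
  have h2 : |LinearMap.det U.toLinearEquiv.toLinearMap| = 1 := by
    rw [← LinearMap.normDet_eq_abs_det]
    exact U.toLinearIsometry.normDet_eq_one
  have h3 : 0 ≤ LinearMap.det S.toLinearMap := by
    have := hS.isSymmetric.det_eq_prod_eigenvalues rfl
    rw [this]
    exact Finset.prod_nonneg fun i _ => hS.nonneg_eigenvalues rfl i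
  rw [h1, LinearMap.det_comp, abs_mul, h2, mul_one, abs_of_nonneg h3]

/-! ### Consequences of the certificate: spanning, uniqueness, extremal volume. -/

section Contact

variable {n : ℕ} {K : Set (EuclideanSpace ℝ (Fin n))} {d : ℝ}

theorem eq_zero_of_forall_norm_add_le {V : Type*} [NormedAddCommGroup V] [NormedSpace ℝ V] {a : V}
    {r : ℝ} (hr : 0 ≤ r) (h : ∀ b : V, ‖b‖ ≤ r → ‖a + b‖ ≤ r) : a = 0 := by
  by_contra ha
  have h0 : 0 < ‖a‖ := norm_pos_iff.2 ha
  have h1 := h ((r / ‖a‖) • a) (by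
    rw [norm_smul, Real.norm_of_nonneg (by positivity), div_mul_cancel₀ _ h0.ne'])
  have h2 : a + (r / ‖a‖) • a = (1 + r / ‖a‖) • a := by rw [add_smul, one_smul]
  rw [h2, norm_smul, Real.norm_of_nonneg (by positivity), add_mul, div_mul_cancel₀ _ h0.ne'] at h1
  linarith

/-- A linear map sending the unit ball into the ball of radius `r` has norm at most `r`. -/
theorem norm_map_le_of_forall_unit {V : Type*} [NormedAddCommGroup V] [NormedSpace ℝ V]
    {f : V →ₗ[ℝ] V} {r : ℝ} (h : ∀ b : V, ‖b‖ ≤ 1 → ‖f b‖ ≤ r) (x : V) : ‖f x‖ ≤ r * ‖x‖ := by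
  rcases eq_or_ne x 0 with rfl | hx
  · simp
  have h0 : 0 < ‖x‖ := norm_pos_iff.2 hx
  have h1 := h (‖x‖⁻¹ • x) (norm_smul_inv_norm hx).le
  rw [map_smul, norm_smul, norm_inv, norm_norm, inv_mul_le_iff₀ h0] at h1
  linarith

/-- An ellipsoid inside an origin-symmetric convex set may be translated to the origin. -/
theorem Convex.mem_of_forall_add_mem {V : Type*} [NormedAddCommGroup V] [NormedSpace ℝ V]
    {K : Set V} (hK : Convex ℝ K) (hneg : ∀ x ∈ K, -x ∈ K) {a : V} {A : V ≃ₗ[ℝ] V}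
    (h : ∀ b, ‖b‖ ≤ 1 → a + A b ∈ K) (b : V) (hb : ‖b‖ ≤ 1) : A b ∈ K := by
  have h1 := h b hb
  have h2 := hneg _ (h (-b) (by rwa [norm_neg]))
  have h3 := hK h1 h2 (by norm_num : (0 : ℝ) ≤ 1 / 2) (by norm_num : (0 : ℝ) ≤ 1 / 2) (by norm_num)
  convert h3 using 1
  rw [map_neg]
  module

/-- An ellipsoid containing an origin-symmetric set may be translated to the origin. -/
theorem norm_symm_le_of_forall_norm_symm_sub_le {V : Type*} [NormedAddCommGroup V]
    [NormedSpace ℝ V] {K : Set V} (hneg : ∀ x ∈ K, -x ∈ K) {a : V} {A : V ≃ₗ[ℝ] V} {r : ℝ}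
    (h : ∀ x ∈ K, ‖A.symm (x - a)‖ ≤ r) (x : V) (hx : x ∈ K) : ‖A.symm x‖ ≤ r := by
  have h1 := h x hx
  have h2 := h (-x) (hneg x hx)
  have h3 : A.symm x = (1 / 2 : ℝ) • (A.symm (x - a) - A.symm (-x - a)) := by
    simp only [map_sub, map_neg]
    module
  rw [h3, norm_smul, Real.norm_of_nonneg (by norm_num)]
  linarith [norm_sub_le (A.symm (x - a)) (A.symm (-x - a))]

/-- Optimality is linearly invariant, so any sandwich of ratio `d` can be made round. This serves
the initial normalization and also the mean sandwich in `norm_map_eq`. -/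
theorem IsSandwichBound.preimage (h : IsSandwichBound K d)
    (S : EuclideanSpace ℝ (Fin n) ≃ₗ[ℝ] EuclideanSpace ℝ (Fin n))
    (hin : ∀ b, ‖b‖ ≤ 1 → S b ∈ K) (hout : ∀ x ∈ K, ‖S.symm x‖ ≤ d) :
    IsDistancePosition (S ⁻¹' K) d where
  isCompact := S.toContinuousLinearEquiv.toHomeomorph.isCompact_preimage.2 h.isCompact
  convex := h.convex.linear_preimage S.toLinearMap
  neg_mem x hx := by
    rw [Set.mem_preimage, map_neg]
    exact h.neg_mem _ hx
  pos := h.pos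
  le_of_sandwich T ρ hρ h1 h2 := by
    refine h.le_of_sandwich (T.trans S) ρ hρ h1 fun x hx => ?_
    rw [LinearEquiv.symm_trans_apply]
    exact h2 _ (by rwa [Set.mem_preimage, LinearEquiv.apply_symm_apply])
  mem_of_norm_le := hin
  norm_le x hx := by simpa using hout _ hx

namespace IsDistancePosition

theorem neg_mem_innerContact (h : IsDistancePosition K d) {u : EuclideanSpace ℝ (Fin n)}
    (hu : u ∈ innerContact K) : -u ∈ innerContact K := by
  refine ⟨by rw [norm_neg, hu.1], fun x hx => ?_⟩
  have := hu.2 _ (h.neg_mem x hx)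
  rwa [inner_neg_left, ← inner_neg_right] at this

/-- `K = -K` lies in the slab `|⟪x, u⟫| ≤ 1` of each inner contact. Testing at `d v` bounds `⟪u ⊗ u,
v ⊗ v⟫ = ⟪u, v⟫²`, and the bound passes to the hulls one variable at a time. -/
theorem exists_certificate (h : IsDistancePosition K d) :
    ∃ M, M ∈ closedConvexHull ℝ (tensorSq '' innerContact K) ∧
      M ∈ closedConvexHull ℝ (tensorSq '' outerContact K d) ∧
      inner ℝ (entries LinearMap.id) M = (1 : ℝ) ∧ inner ℝ M M ≤ 1 / d ^ 2 := by
  obtain ⟨M, hM1, hM2⟩ := h.exists_mem_closedConvexHull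
  have hd := h.pos
  refine ⟨M, hM1, hM2, ?_, ?_⟩
  · refine inner_eq_of_mem_closedConvexHull ?_ hM1
    rintro _ ⟨u, hu, rfl⟩
    rw [inner_entries_tensorSq, LinearMap.id_apply, real_inner_self_eq_norm_sq, hu.1, one_pow]
  · refine inner_le_of_mem_closedConvexHull ?_ hM2
    rintro _ ⟨v, hv, rfl⟩
    rw [real_inner_comm]
    refine inner_le_of_mem_closedConvexHull ?_ hM1
    rintro _ ⟨u, hu, rfl⟩
    rw [inner_tensorSq]
    have h1 := hu.2 _ hv.2
    have h2 := hu.2 _ (h.neg_mem _ hv.2)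
    rw [inner_neg_left] at h2
    rw [inner_smul_left, conj_trivial] at h1 h2
    rw [le_div_iff₀ (by positivity), mul_comm, ← mul_pow]
    exact (sq_le_one_iff_abs_le_one _).2 (abs_le.2 ⟨by linarith, h1⟩)

theorem outerContact_nonempty (h : IsDistancePosition K d) : (outerContact K d).Nonempty := by
  obtain ⟨M, -, hM, -⟩ := h.exists_certificate
  by_contra hne
  rw [Set.not_nonempty_iff_eq_empty.1 hne, Set.image_empty] at hM
  simp [closedConvexHull_eq_closure_convexHull] at hM

/-- `φ` projects onto the line of `w`, so `J - φ` has squared norm `n - 1` and pairs with `M` to 1.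
Expanding `‖M - (J - φ) / d²‖² ≥ 0` gives the bound. -/
theorem sq_le_of_inner_eq_zero {M : EuclideanSpace ℝ (Fin n × Fin n)}
    {w : EuclideanSpace ℝ (Fin n)} (hd : 0 < d) (hM : inner ℝ (entries LinearMap.id) M = (1 : ℝ))
    (hMM : inner ℝ M M ≤ 1 / d ^ 2) (hw : w ≠ 0) (hwM : inner ℝ (tensorSq w) M = (0 : ℝ)) :
    d ^ 2 ≤ n - 1 := by
  set J : EuclideanSpace ℝ (Fin n × Fin n) := entries LinearMap.id with hJ
  set φ := (‖w‖ ^ 2)⁻¹ • tensorSq w with hφ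
  have hw0 : ‖w‖ ≠ 0 := norm_ne_zero_iff.2 hw
  have hJJ : inner ℝ J J = (n : ℝ) := by
    rw [hJ, inner_entries_id]
    simp
  have hJφ : inner ℝ J φ = (1 : ℝ) := by
    rw [hφ, inner_smul_right, inner_entries_tensorSq, LinearMap.id_apply,
      real_inner_self_eq_norm_sq]
    field_simp
  have hφφ : inner ℝ φ φ = (1 : ℝ) := by
    rw [hφ, inner_smul_right, inner_smul_left, inner_tensorSq, conj_trivial,
      real_inner_self_eq_norm_sq]
    field_simp
  have hφM : inner ℝ φ M = (0 : ℝ) := by rw [hφ, inner_smul_left, hwM, mul_zero]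
  have h0 : 0 ≤ inner ℝ (M - (1 / d ^ 2) • (J - φ)) (M - (1 / d ^ 2) • (J - φ)) :=
    real_inner_self_nonneg
  simp only [inner_sub_left, inner_sub_right, inner_smul_left, inner_smul_right, conj_trivial] at h0
  rw [real_inner_comm J M, real_inner_comm φ M, real_inner_comm J φ, hM, hφM, hJφ, hφφ, hJJ] at h0
  have h1 : 1 / d ^ 2 * (1 / d ^ 2 * (n - 1)) ≥ 1 / d ^ 2 * 1 := by linarith
  have h2 := le_of_mul_le_mul_left h1 (by positivity)
  rw [div_mul_eq_mul_div, one_mul, le_div_iff₀ (by positivity), one_mul] at h2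
  exact h2

theorem eq_zero_of_inner_innerContact (h : IsDistancePosition K d) (hn : (n : ℝ) - 1 < d ^ 2)
    {w : EuclideanSpace ℝ (Fin n)} (hw : ∀ u ∈ innerContact K, inner ℝ w u = (0 : ℝ)) : w = 0 := by
  obtain ⟨M, hM1, -, hM, hMM⟩ := h.exists_certificate
  by_contra hw0
  refine hn.not_ge (sq_le_of_inner_eq_zero h.pos hM hMM hw0
    (inner_eq_of_mem_closedConvexHull ?_ hM1))
  rintro _ ⟨u, hu, rfl⟩
  rw [inner_tensorSq, hw u hu, zero_pow two_ne_zero]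

theorem eq_zero_of_inner_outerContact (h : IsDistancePosition K d) (hn : (n : ℝ) - 1 < d ^ 2)
    {w : EuclideanSpace ℝ (Fin n)} (hw : ∀ v ∈ outerContact K d, inner ℝ w v = (0 : ℝ)) :
    w = 0 := by
  obtain ⟨M, -, hM2, hM, hMM⟩ := h.exists_certificate
  by_contra hw0
  refine hn.not_ge (sq_le_of_inner_eq_zero h.pos hM hMM hw0
    (inner_eq_of_mem_closedConvexHull ?_ hM2))
  rintro _ ⟨u, hu, rfl⟩
  rw [inner_tensorSq, hw u hu, zero_pow two_ne_zero]

theorem inner_center_eq_zero (h : IsDistancePosition K d) (hn : (n : ℝ) - 1 < d ^ 2)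
    {a : EuclideanSpace ℝ (Fin n)} (ha : ∀ b, ‖b‖ ≤ 1 → a + b ∈ K) : a = 0 := by
  -- The point `a + u` must not cross the supporting hyperplane at `u`; `-u` gives the reverse sign.
  have key : ∀ u ∈ innerContact K, inner ℝ a u ≤ (0 : ℝ) := by
    intro u hu
    have := hu.2 _ (ha u hu.1.le)
    rw [inner_add_left, real_inner_self_eq_norm_sq, hu.1] at this
    linarith
  refine h.eq_zero_of_inner_innerContact hn fun u hu => le_antisymm (key u hu) ?_
  have := key _ (h.neg_mem_innerContact hu)
  rw [inner_neg_right] at this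
  linarith

/-- One antipodal pair `±d v` suffices, by the parallelogram law. -/
theorem outer_center_eq_zero (h : IsDistancePosition K d)
    {a : EuclideanSpace ℝ (Fin n)} (ha : ∀ x ∈ K, ‖x - a‖ ≤ d) : a = 0 := by
  obtain ⟨v, hv⟩ := h.outerContact_nonempty
  have h1 := pow_le_pow_left₀ (norm_nonneg _) (ha _ hv.2) 2
  have h2 := pow_le_pow_left₀ (norm_nonneg _) (ha _ (h.neg_mem _ hv.2)) 2
  rw [norm_sub_sq_real, norm_smul, hv.1, Real.norm_of_nonneg h.pos.le] at h1
  rw [norm_sub_sq_real, norm_neg, norm_smul, hv.1, Real.norm_of_nonneg h.pos.le,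
    inner_neg_left] at h2
  have h3 : ‖a‖ ^ 2 = 0 := le_antisymm (by linarith) (sq_nonneg _)
  simpa using h3

/-- Two origin-centered sandwiches of smallest ratio agree if this ratio is large. -/
theorem norm_map_eq (h : IsDistancePosition K d) (hn : (n : ℝ) - 1 < d ^ 2)
    {A : EuclideanSpace ℝ (Fin n) ≃ₗ[ℝ] EuclideanSpace ℝ (Fin n)}
    (hin : ∀ b, ‖b‖ ≤ 1 → A b ∈ K) (hout : ∀ x ∈ K, ‖A.symm x‖ ≤ d)
    (x : EuclideanSpace ℝ (Fin n)) : ‖A x‖ = ‖x‖ := by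
  obtain ⟨S, U, hS, hSU⟩ := A.exists_polar
  have hSin : ∀ b, ‖b‖ ≤ 1 → S b ∈ K := by
    intro b hb
    have := hin (U.symm b) (by rwa [LinearIsometryEquiv.norm_map])
    rwa [hSU, LinearIsometryEquiv.apply_symm_apply] at this
  have hSout : ∀ x ∈ K, ‖S.symm x‖ ≤ d := by
    intro x hx
    have h1 : S.symm x = U (A.symm x) := by
      rw [LinearEquiv.symm_apply_eq, ← hSU, LinearEquiv.apply_symm_apply]
    rw [h1, LinearIsometryEquiv.norm_map]
    exact hout x hx
  suffices hfix : ∀ y, S y = y by rw [hSU, hfix, LinearIsometryEquiv.norm_map]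
  let T₀ : EuclideanSpace ℝ (Fin n) →ₗ[ℝ] EuclideanSpace ℝ (Fin n) :=
    (1 / 2 : ℝ) • (LinearMap.id + S.toLinearMap)
  have hT₀ : ∀ y, T₀ y = (1 / 2 : ℝ) • (y + S y) := fun y => rfl
  have hinj : Function.Injective T₀ := by
    rw [injective_iff_map_eq_zero]
    intro y hy
    have h1 : inner ℝ (T₀ y) y = (0 : ℝ) := by rw [hy, inner_zero_left]
    rw [hT₀, inner_smul_left, inner_add_left, real_inner_self_eq_norm_sq, conj_trivial] at h1
    have h2 : 0 ≤ inner ℝ (S y) y := hS.inner_nonneg_left y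
    have h3 : ‖y‖ ^ 2 = 0 := le_antisymm (by linarith) (sq_nonneg _)
    simpa using h3
  let T := LinearEquiv.ofInjectiveEndo T₀ hinj
  have hT : ∀ y, T y = (1 / 2 : ℝ) • (y + S y) := fun y => rfl
  -- By Cauchy–Schwarz the right side is at most `d²` on `K`, which is why the mean sandwich keeps
  -- the ratio `d`.
  have hnorm : ∀ x, ‖T.symm x‖ ^ 2 ≤ inner ℝ x (S.symm x) := by
    intro x
    have h1 := hS.norm_sq_le_inner (z := T.symm x) (w := S.symm x) (by
      have := T.apply_symm_apply x
      rw [hT] at this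
      change T.symm x + S (T.symm x) = (2 : ℝ) • S (S.symm x)
      rw [S.apply_symm_apply]
      conv_rhs => rw [← this]
      module)
    change _ ≤ inner ℝ (S (S.symm x)) (S.symm x) at h1
    rwa [S.apply_symm_apply] at h1
  have hpos : IsDistancePosition (T ⁻¹' K) d := by
    refine h.toIsSandwichBound.preimage T (fun b hb => ?_) fun x hx => ?_
    · rw [hT, smul_add]
      exact h.convex (h.mem_of_norm_le b hb) (hSin b hb) (by norm_num) (by norm_num) (by norm_num)
    · have h1 := (hnorm x).trans (real_inner_le_norm _ _)
      have h2 := mul_le_mul (h.norm_le x hx) (hSout x hx) (norm_nonneg _) h.pos.le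
      exact (sq_le_sq₀ (norm_nonneg _) h.pos.le).1 (by linarith)
  intro y
  rw [← sub_eq_zero]
  refine hpos.eq_zero_of_inner_outerContact hn fun v hv => ?_
  -- At an outer contact of the mean position the chain `d² ≤ ⟪x, S⁻¹x⟫ ≤ ‖x‖ ‖S⁻¹x‖ ≤ d²` is tight,
  -- so `x = S⁻¹x`.
  have hvfix : S v = v := by
    set x := T (d • v) with hx
    have hxK : x ∈ K := hv.2
    have h1 := hnorm x
    rw [hx, T.symm_apply_apply, ← hx, norm_smul, hv.1, mul_one,
      Real.norm_of_nonneg h.pos.le] at h1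
    have h2 := norm_sub_sq_real x (S.symm x)
    have h3 := pow_le_pow_left₀ (norm_nonneg _) (h.norm_le x hxK) 2
    have h4 := pow_le_pow_left₀ (norm_nonneg _) (hSout x hxK) 2
    have h5 : ‖x - S.symm x‖ ^ 2 = 0 := le_antisymm (by linarith) (sq_nonneg _)
    have h6 : x = S.symm x := by simpa [sub_eq_zero] using h5
    have h7 : S x = x := by
      conv_lhs => rw [h6]
      exact S.apply_symm_apply x
    have h8 : T x = x := by
      rw [hT, h7]
      module
    have h9 : x = d • v := T.injective (by rw [h8])
    rw [h9, map_smul] at h7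
    exact smul_right_injective _ h.pos.ne' h7
  have hs := hS.isSymmetric y v
  change inner ℝ (S y) v = inner ℝ y (S v) at hs
  rw [inner_sub_left, hs, hvfix, sub_self]

/-- The pair of balls is the only sandwich of smallest ratio if this ratio is large. -/
theorem sandwich_unique (h : IsDistancePosition K d) (hn : (n : ℝ) - 1 < d ^ 2 ∨ d ≤ 1)
    {A : EuclideanSpace ℝ (Fin n) ≃ₗ[ℝ] EuclideanSpace ℝ (Fin n)}
    {a₁ a₂ : EuclideanSpace ℝ (Fin n)} (hin : ∀ b, ‖b‖ ≤ 1 → a₁ + A b ∈ K)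
    (hout : ∀ x ∈ K, ‖A.symm (x - a₂)‖ ≤ d) : a₁ = 0 ∧ a₂ = 0 ∧ ∀ x, ‖A x‖ = ‖x‖ := by
  have hin' := h.convex.mem_of_forall_add_mem h.neg_mem hin
  have hout' := norm_symm_le_of_forall_norm_symm_sub_le h.neg_mem hout
  have hA : ∀ x, ‖A x‖ = ‖x‖ := by
    rcases hn with hn | hd
    · exact h.norm_map_eq hn hin' hout'
    -- Here `K` is the unit ball itself, so `A` and `A⁻¹` are both contractions.
    · intro x
      refine le_antisymm ?_ ?_
      · simpa using norm_map_le_of_forall_unit (f := A.toLinearMap)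
          (fun b hb => (h.norm_le _ (hin' b hb)).trans hd) x
      · simpa using norm_map_le_of_forall_unit (f := A.symm.toLinearMap)
          (fun b hb => (hout' b (h.mem_of_norm_le b hb)).trans hd) (A x)
  have hA' : ∀ x, ‖A.symm x‖ = ‖x‖ := fun x => by rw [← hA, A.apply_symm_apply]
  have h1 : ∀ b, ‖b‖ ≤ 1 → a₁ + b ∈ K := fun b hb => by
    simpa using hin (A.symm b) (by rwa [hA'])
  have h2 : ∀ x ∈ K, ‖x - a₂‖ ≤ d := fun x hx => by rw [← hA']; exact hout x hx
  refine ⟨?_, h.outer_center_eq_zero h2, hA⟩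
  rcases hn with hn | hd
  · exact h.inner_center_eq_zero hn h1
  · exact eq_zero_of_forall_norm_add_le zero_le_one fun b hb => (h.norm_le _ (h1 b hb)).trans hd

/-- Trace 1 and `⟪M, M⟫ ≤ 1 / n` force `M = 1 / n`, so pairing with `M` averages the quadratic form
of `A` to `trace A / n`. -/
theorem trace_le (h : IsDistancePosition K d) (hd : d ^ 2 = n)
    {A : EuclideanSpace ℝ (Fin n) →ₗ[ℝ] EuclideanSpace ℝ (Fin n)}
    (hA : (∀ u ∈ innerContact K, inner ℝ u (A u) ≤ (1 : ℝ)) ∨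
      ∀ v ∈ outerContact K d, inner ℝ v (A v) ≤ (1 : ℝ)) :
    LinearMap.trace ℝ _ A ≤ n := by
  obtain ⟨M, hM1, hM2, hM, hMM⟩ := h.exists_certificate
  have hn : (0 : ℝ) < n := by rw [← hd]; exact pow_pos h.pos 2
  set J : EuclideanSpace ℝ (Fin n × Fin n) := entries LinearMap.id with hJ
  have hJJ : inner ℝ J J = (n : ℝ) := by
    rw [hJ, inner_entries_id]
    simp
  have hMJ : M = (1 / n : ℝ) • J := by
    have h0 : inner ℝ (M - (1 / n : ℝ) • J) (M - (1 / n : ℝ) • J) ≤ (0 : ℝ) := by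
      simp only [inner_sub_left, inner_sub_right, inner_smul_left, inner_smul_right, conj_trivial]
      rw [real_inner_comm J M, hM, hJJ]
      rw [hd] at hMM
      field_simp at hMM ⊢
      linarith
    rw [real_inner_self_eq_norm_sq] at h0
    simpa [sub_eq_zero] using le_antisymm h0 (sq_nonneg _)
  have h1 : inner ℝ (entries A) M ≤ (1 : ℝ) := by
    rcases hA with hA | hA
    · refine inner_le_of_mem_closedConvexHull ?_ hM1
      rintro _ ⟨u, hu, rfl⟩
      rw [inner_entries_tensorSq]
      exact hA u hu
    · refine inner_le_of_mem_closedConvexHull ?_ hM2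
      rintro _ ⟨u, hu, rfl⟩
      rw [inner_entries_tensorSq]
      exact hA u hu
  rw [hMJ, inner_smul_right, inner_entries_id, one_div, inv_mul_le_iff₀ hn, mul_one] at h1
  exact h1

/-- If the smallest ratio is `√n`, then the unit ball is the John ellipsoid. -/
theorem eq_or_abs_det_lt_one (h : IsDistancePosition K d) (hd : d ^ 2 = n)
    {A : EuclideanSpace ℝ (Fin n) ≃ₗ[ℝ] EuclideanSpace ℝ (Fin n)} {a : EuclideanSpace ℝ (Fin n)}
    (hin : ∀ b, ‖b‖ ≤ 1 → a + A b ∈ K) :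
    (a = 0 ∧ ∀ x, ‖A x‖ = ‖x‖) ∨ |LinearMap.det A.toLinearMap| < 1 := by
  obtain ⟨S, U, hS, hSU, hdet⟩ := A.exists_polar_abs_det
  have hSin : ∀ b, ‖b‖ ≤ 1 → a + S b ∈ K := by
    intro b hb
    have := hin (U.symm b) (by rwa [LinearIsometryEquiv.norm_map])
    rwa [hSU, LinearIsometryEquiv.apply_symm_apply] at this
  by_cases hS1 : S = LinearEquiv.refl ℝ _
  · left
    refine ⟨h.inner_center_eq_zero (by linarith) fun b hb => ?_, fun x => ?_⟩
    · simpa [hS1] using hSin b hb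
    · rw [hSU, hS1, LinearEquiv.refl_apply, LinearIsometryEquiv.norm_map]
  · right
    rw [hdet]
    refine hS.det_lt_one ?_ hS1
    rw [finrank_euclideanSpace_fin]
    refine h.trace_le hd (Or.inl fun u hu => ?_)
    have h1 := hu.2 _ (h.convex.mem_of_forall_add_mem h.neg_mem hSin u hu.1.le)
    rwa [real_inner_comm] at h1

/-- If the smallest ratio `d` is `√n`, then the ball of radius `d` is the Loewner ellipsoid. -/
theorem eq_or_lt_abs_det (h : IsDistancePosition K d) (hd : d ^ 2 = n)
    {A : EuclideanSpace ℝ (Fin n) ≃ₗ[ℝ] EuclideanSpace ℝ (Fin n)} {a : EuclideanSpace ℝ (Fin n)}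
    (hout : ∀ x ∈ K, ‖A.symm (x - a)‖ ≤ 1) :
    (a = 0 ∧ ∀ x, ‖A x‖ = d * ‖x‖) ∨ d ^ n < |LinearMap.det A.toLinearMap| := by
  obtain ⟨S, U, hS, hSU, hdet⟩ := A.exists_polar_abs_det
  have hd0 := h.pos
  have hSout : ∀ x ∈ K, ‖S.symm (x - a)‖ ≤ 1 := by
    intro x hx
    have h1 : S.symm (x - a) = U (A.symm (x - a)) := by
      rw [LinearEquiv.symm_apply_eq, ← hSU, LinearEquiv.apply_symm_apply]
    rw [h1, LinearIsometryEquiv.norm_map]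
    exact hout x hx
  -- `R = d S⁻¹` sends an outer contact `v` to `S⁻¹(d v)`, of norm at most 1, so the trace bound
  -- applies; `det R < 1` reads `dⁿ < det S`.
  let R : EuclideanSpace ℝ (Fin n) ≃ₗ[ℝ] EuclideanSpace ℝ (Fin n) :=
    S.symm.trans (LinearEquiv.smulOfNeZero ℝ _ d hd0.ne')
  have hR : ∀ x, R x = d • S.symm x := fun x => rfl
  have hRl : R.toLinearMap = d • S.symm.toLinearMap := rfl
  have hRpos : R.toLinearMap.IsPositive := by
    rw [hRl]
    exact LinearMap.IsPositive.smul_of_nonneg hS.toLinearMap_symm hd0.le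
  by_cases hR1 : R = LinearEquiv.refl ℝ _
  · left
    have hSx : ∀ x, S x = d • x := by
      intro x
      have := hR (S x)
      rwa [hR1, LinearEquiv.refl_apply, S.symm_apply_apply] at this
    refine ⟨h.outer_center_eq_zero fun x hx => ?_, fun x => ?_⟩
    · have h1 : x - a = d • S.symm (x - a) := by rw [← hR, hR1, LinearEquiv.refl_apply]
      rw [h1, norm_smul, Real.norm_of_nonneg hd0.le]
      exact mul_le_of_le_one_right hd0.le (hSout x hx)
    · rw [hSU, hSx, norm_smul, Real.norm_of_nonneg hd0.le, LinearIsometryEquiv.norm_map]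
  · right
    have hlt := hRpos.det_lt_one (by
      rw [finrank_euclideanSpace_fin]
      refine h.trace_le hd (Or.inr fun v hv => ?_)
      have h1 := norm_symm_le_of_forall_norm_symm_sub_le h.neg_mem hSout _ hv.2
      rw [map_smul, ← hR] at h1
      have h2 := real_inner_le_norm v (R v)
      rw [hv.1, one_mul] at h2
      exact h2.trans h1) hR1
    have hmul : LinearMap.det S.toLinearMap * LinearMap.det S.symm.toLinearMap = 1 :=
      S.det_mul_det_symm
    have hSd : 0 < LinearMap.det S.toLinearMap := by
      rcases lt_or_eq_of_le (abs_nonneg (LinearMap.det A.toLinearMap)) with h0 | h0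
      · rwa [hdet] at h0
      · rw [← hdet, ← h0, zero_mul] at hmul
        exact absurd hmul zero_ne_one
    rw [hRl, LinearMap.det_smul, finrank_euclideanSpace_fin] at hlt
    rw [hdet]
    have h3 := mul_lt_mul_of_pos_left hlt hSd
    rw [mul_left_comm, hmul] at h3
    linarith

end IsDistancePosition

end Contact

/-! ### Ellipsoids in coordinates and their volumes. -/

section Ellipsoid

variable {n : ℕ}

/-- The ellipsoid `a + A Bⁿ`. -/
def ellipsoid (A : EuclideanSpace ℝ (Fin n) ≃ₗ[ℝ] EuclideanSpace ℝ (Fin n))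
    (a : EuclideanSpace ℝ (Fin n)) : Set (EuclideanSpace ℝ (Fin n)) :=
  (fun b => a + A b) '' unitBall n

/-- The operator `r • A`. -/
noncomputable def LinearEquiv.scale {V : Type*} [AddCommGroup V] [Module ℝ V] (A : V ≃ₗ[ℝ] V)
    {r : ℝ} (hr : r ≠ 0) : V ≃ₗ[ℝ] V :=
  A.trans (LinearEquiv.smulOfNeZero ℝ V r hr)

theorem LinearEquiv.scale_apply {V : Type*} [AddCommGroup V] [Module ℝ V] (A : V ≃ₗ[ℝ] V)
    {r : ℝ} (hr : r ≠ 0) (x : V) : A.scale hr x = r • A x := rfl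

theorem LinearEquiv.scale_symm_apply {V : Type*} [AddCommGroup V] [Module ℝ V] (A : V ≃ₗ[ℝ] V)
    {r : ℝ} (hr : r ≠ 0) (x : V) : (A.scale hr).symm x = r⁻¹ • A.symm x := by
  rw [LinearEquiv.symm_apply_eq, LinearEquiv.scale_apply, map_smul, A.apply_symm_apply,
    smul_inv_smul₀ hr]

variable {A : EuclideanSpace ℝ (Fin n) ≃ₗ[ℝ] EuclideanSpace ℝ (Fin n)}
  {a x : EuclideanSpace ℝ (Fin n)}

theorem mem_unitBall : x ∈ unitBall n ↔ ‖x‖ ≤ 1 := mem_closedBall_zero_iff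

theorem mem_ellipsoid : x ∈ ellipsoid A a ↔ ‖A.symm (x - a)‖ ≤ 1 := by
  constructor
  · rintro ⟨b, hb, rfl⟩
    simpa using mem_unitBall.1 hb
  · intro h
    exact ⟨A.symm (x - a), mem_unitBall.2 h, by simp⟩

theorem mem_ellipsoid_scale {r : ℝ} (hr : 0 < r) :
    x ∈ ellipsoid (A.scale hr.ne') a ↔ ‖A.symm (x - a)‖ ≤ r := by
  rw [mem_ellipsoid, LinearEquiv.scale_symm_apply, norm_smul, norm_inv, Real.norm_of_nonneg hr.le,
    inv_mul_le_iff₀ hr, mul_one]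

theorem add_map_mem_ellipsoid {b : EuclideanSpace ℝ (Fin n)} (hb : ‖b‖ ≤ 1) :
    a + A b ∈ ellipsoid A a := ⟨b, mem_unitBall.2 hb, rfl⟩

theorem isEllipsoid_ellipsoid : IsEllipsoid (ellipsoid A a) := by
  refine ⟨A.toAffineEquiv.trans (AffineEquiv.constVAdd ℝ _ a), ?_⟩
  rfl

theorem IsEllipsoid.exists_eq_ellipsoid {E : Set (EuclideanSpace ℝ (Fin n))}
    (hE : IsEllipsoid E) : ∃ A a, E = ellipsoid A a := by
  obtain ⟨T, rfl⟩ := hE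
  refine ⟨T.linear, T 0, Set.image_congr fun b _ => ?_⟩
  have := T.map_vadd 0 b
  simpa [add_comm] using this

theorem vadd_smul_ellipsoid {r : ℝ} (hr : 0 < r) (v : EuclideanSpace ℝ (Fin n)) :
    v +ᵥ (r • ellipsoid A a) = ellipsoid (A.scale hr.ne') (v + r • a) := by
  ext x
  rw [Set.mem_vadd_set_iff_neg_vadd_mem, Set.mem_smul_set_iff_inv_smul_mem₀ hr.ne',
    mem_ellipsoid, mem_ellipsoid, LinearEquiv.scale_symm_apply, ← map_smul, smul_sub, smul_add,
    inv_smul_smul₀ hr.ne', vadd_eq_add, smul_add, smul_neg]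
  rw [show -(r⁻¹ • v) + r⁻¹ • x - a = r⁻¹ • x - (r⁻¹ • v + a) by abel]

theorem volume_ellipsoid :
    volume (ellipsoid A a) =
      ENNReal.ofReal |LinearMap.det A.toLinearMap| * volume (unitBall n) := by
  have : ellipsoid A a = a +ᵥ (A.toLinearMap '' unitBall n) := by
    rw [← Set.image_vadd, Set.image_image]
    rfl
  rw [this, measure_vadd, Measure.addHaar_image_linearMap]

theorem volume_ellipsoid_lt {A' : EuclideanSpace ℝ (Fin n) ≃ₗ[ℝ] EuclideanSpace ℝ (Fin n)}
    {a' : EuclideanSpace ℝ (Fin n)}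
    (h : |LinearMap.det A.toLinearMap| < |LinearMap.det A'.toLinearMap|) :
    volume (ellipsoid A a) < volume (ellipsoid A' a') := by
  rw [volume_ellipsoid, volume_ellipsoid]
  refine ENNReal.mul_lt_mul_left (Metric.measure_closedBall_pos _ _ one_pos).ne'
    measure_closedBall_lt_top.ne ?_
  exact (ENNReal.ofReal_lt_ofReal_iff (lt_of_le_of_lt (abs_nonneg _) h)).2 h

end Ellipsoid

/-! ### The Banach–Mazur distance as an attained sandwich ratio. -/

section Sandwich

variable {n : ℕ} {K : Set (EuclideanSpace ℝ (Fin n))} {c : EuclideanSpace ℝ (Fin n)}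

/-- `r` is the ratio of a sandwich of `K` by homothetic ellipsoids centered at the origin. -/
def IsSandwichRatio (K : Set (EuclideanSpace ℝ (Fin n))) (r : ℝ) : Prop :=
  ∃ A : EuclideanSpace ℝ (Fin n) ≃ₗ[ℝ] EuclideanSpace ℝ (Fin n),
    (∀ b, ‖b‖ ≤ 1 → A b ∈ K) ∧ ∀ x ∈ K, ‖A.symm x‖ ≤ r

/-- For a symmetric body the centers may be placed at its center of symmetry. -/
theorem exists_map_vadd_iff_isSandwichRatio (hK : Convex ℝ K)
    (hc : ∀ x ∈ K, (2 : ℝ) • c - x ∈ K) {r : ℝ} (hr : 0 < r) :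
    (∃ (T : EuclideanSpace ℝ (Fin n) ≃ₗ[ℝ] EuclideanSpace ℝ (Fin n))
      (u v : EuclideanSpace ℝ (Fin n)), u +ᵥ K ⊆ T '' (v +ᵥ unitBall n) ∧
        T '' (v +ᵥ unitBall n) ⊆ r • (u +ᵥ K)) ↔
    IsSandwichRatio ((fun x => c + x) ⁻¹' K) r := by
  have hneg : ∀ x ∈ (fun x => c + x) ⁻¹' K, -x ∈ (fun x => c + x) ⁻¹' K := by
    intro x hx
    have := hc _ hx
    rw [Set.mem_preimage]
    convert this using 1
    module
  have hconv : Convex ℝ ((fun x => c + x) ⁻¹' K) := hK.translate_preimage_right c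
  constructor
  · rintro ⟨T, u, v, h1, h2⟩
    -- The inner and outer ellipsoids need not be concentric; each is recentred separately by
    -- symmetry.
    refine ⟨T.scale (inv_ne_zero hr.ne'), ?_, ?_⟩
    · refine hconv.mem_of_forall_add_mem (a := r⁻¹ • T v - u - c) hneg fun b hb => ?_
      obtain ⟨_, ⟨k, hk, rfl⟩, hk'⟩ := h2 ⟨v + b, ⟨b, mem_unitBall.2 hb, rfl⟩, rfl⟩
      have hk2 : k = r⁻¹ • T (v + b) - u := by
        rw [← hk']
        simp [smul_smul, inv_mul_cancel₀ hr.ne']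
      rw [Set.mem_preimage]
      convert hk using 1
      rw [hk2, LinearEquiv.scale_apply, map_add]
      module
    · have h3 := norm_symm_le_of_forall_norm_symm_sub_le (A := T) (a := T v - u - c) (r := 1)
        hneg fun x hx => by
          obtain ⟨_, ⟨b, hb, rfl⟩, hb'⟩ := h1 ⟨c + x, hx, rfl⟩
          have : x - (T v - u - c) = T b := by
            simp only [vadd_eq_add, map_add] at hb'
            rw [← sub_eq_iff_eq_add'.2 hb'.symm]
            abel
          rw [this, T.symm_apply_apply]
          exact mem_unitBall.1 hb
      intro x hx
      rw [LinearEquiv.scale_symm_apply, inv_inv, norm_smul, Real.norm_of_nonneg hr.le]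
      exact mul_le_of_le_one_right hr.le (h3 x hx)
  · rintro ⟨A, h1, h2⟩
    refine ⟨A.scale hr.ne', -c, 0, ?_, ?_⟩
    · rintro _ ⟨k, hk, rfl⟩
      have hx := h2 (-c + k) (by rw [Set.mem_preimage]; simpa using hk)
      refine ⟨(A.scale hr.ne').symm (-c + k), ⟨_, mem_unitBall.2 ?_, zero_vadd _ _⟩, by simp⟩
      rw [LinearEquiv.scale_symm_apply, norm_smul, norm_inv, Real.norm_of_nonneg hr.le,
        inv_mul_le_iff₀ hr, mul_one]
      exact hx
    · rintro _ ⟨_, ⟨b, hb, rfl⟩, rfl⟩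
      have := h1 b (mem_unitBall.1 hb)
      refine ⟨A b, ⟨c + A b, this, by simp⟩, ?_⟩
      simp [LinearEquiv.scale_apply]

/-- The infimum of the ratios of origin-centered sandwiches is attained. -/
theorem isSandwichRatio_sInf (hn : 1 ≤ n) (hcomp : IsCompact K) {r : ℝ} (hr : 0 < r)
    (hball : ∀ x, ‖x‖ ≤ r → x ∈ K) :
    0 < sInf {ρ : ℝ | 0 < ρ ∧ IsSandwichRatio K ρ} ∧
      IsSandwichRatio K (sInf {ρ : ℝ | 0 < ρ ∧ IsSandwichRatio K ρ}) := by
  set s := {ρ : ℝ | 0 < ρ ∧ IsSandwichRatio K ρ} with hs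
  obtain ⟨R, hR, hRK⟩ := hcomp.isBounded.exists_pos_norm_le
  have hne : s.Nonempty := by
    refine ⟨R / r, div_pos hR hr, (LinearEquiv.refl ℝ _).scale hr.ne', fun b hb => ?_,
      fun x hx => ?_⟩
    · refine hball _ ?_
      rw [LinearEquiv.scale_apply, LinearEquiv.refl_apply, norm_smul, Real.norm_of_nonneg hr.le]
      exact mul_le_of_le_one_right hr.le hb
    · rw [LinearEquiv.scale_symm_apply, LinearEquiv.refl_symm, LinearEquiv.refl_apply, norm_smul,
        norm_inv, Real.norm_of_nonneg hr.le, div_eq_inv_mul]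
      exact mul_le_mul_of_nonneg_left (hRK x hx) (inv_nonneg.2 hr.le)
  have hbdd : BddBelow s := ⟨0, fun ρ hρ => hρ.1.le⟩
  obtain ⟨ρ, -, hρ, hρs⟩ := exists_seq_tendsto_sInf hne hbdd
  set d := sInf s with hd
  choose hρ0 A hA1 hA2 using hρs
  let F : ℕ → EuclideanSpace ℝ (Fin n) →L[ℝ] EuclideanSpace ℝ (Fin n) := fun k =>
    LinearMap.toContinuousLinearMap (A k).toLinearMap
  have hFA : ∀ k x, F k x = A k x := fun k x => rfl
  have hF : ∀ k, F k ∈ Metric.closedBall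
      (0 : EuclideanSpace ℝ (Fin n) →L[ℝ] EuclideanSpace ℝ (Fin n)) R := by
    intro k
    rw [mem_closedBall_zero_iff]
    exact ContinuousLinearMap.opNorm_le_bound _ hR.le fun x =>
      norm_map_le_of_forall_unit (f := (A k).toLinearMap) (fun b hb => hRK _ (hA1 k b hb)) x
  have : ProperSpace (EuclideanSpace ℝ (Fin n) →L[ℝ] EuclideanSpace ℝ (Fin n)) :=
    FiniteDimensional.proper ℝ _
  obtain ⟨G, -, φ, hφ, hG⟩ := (isCompact_closedBall _ R).tendsto_subseq hF
  have hGx : ∀ x, Filter.Tendsto (fun k => F (φ k) x) Filter.atTop (nhds (G x)) := fun x =>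
    ((ContinuousLinearMap.apply ℝ (EuclideanSpace ℝ (Fin n)) x).continuous.tendsto G).comp hG
  have hρφ : Filter.Tendsto (fun k => ρ (φ k)) Filter.atTop (nhds d) :=
    hρ.comp hφ.tendsto_atTop
  -- Since `rB ⊆ K`, the inverses stay bounded, so the limit operator is invertible.
  have hsymm : ∀ k x, ‖(A k).symm x‖ ≤ ρ k / r * ‖x‖ := by
    intro k x
    refine norm_map_le_of_forall_unit (f := (A k).symm.toLinearMap) (fun b hb => ?_) x
    have := hA2 k (r • b) (hball _ (by
      rw [norm_smul, Real.norm_of_nonneg hr.le]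
      exact mul_le_of_le_one_right hr.le hb))
    rw [map_smul, norm_smul, Real.norm_of_nonneg hr.le] at this
    rw [le_div_iff₀ hr, mul_comm]
    exact this
  have hlow : ∀ k z, ‖z‖ ≤ ρ k / r * ‖F k z‖ := fun k z => by
    have := hsymm k (A k z)
    rwa [(A k).symm_apply_apply] at this
  have hGlow : ∀ z, ‖z‖ ≤ d / r * ‖G z‖ := fun z =>
    ge_of_tendsto' ((hρφ.div_const r).mul (hGx z).norm) fun k => hlow (φ k) z
  have hinj : Function.Injective G.toLinearMap := by
    rw [injective_iff_map_eq_zero]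
    intro z hz
    have h1 := hGlow z
    rw [show G z = 0 from hz, norm_zero, mul_zero] at h1
    exact norm_le_zero_iff.1 h1
  let B := LinearEquiv.ofInjectiveEndo G.toLinearMap hinj
  have hB : ∀ x, B x = G x := fun x => rfl
  have hdpos : 0 < d := by
    refine lt_of_le_of_ne (le_csInf hne fun ρ hρ => hρ.1.le) fun h0 => ?_
    -- A nonzero vector exists because `n ≥ 1`; it excludes `d = 0`.
    have h1 := hGlow (EuclideanSpace.single ⟨0, hn⟩ 1)
    rw [← h0] at h1
    norm_num at h1
  refine ⟨hdpos, B, fun b hb => ?_, fun x hx => ?_⟩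
  · exact hcomp.isClosed.mem_of_tendsto (hGx b)
      (Filter.Eventually.of_forall fun k => hA1 (φ k) b hb)
  · set y := B.symm x with hy
    have hGy : G y = x := by rw [← hB, hy, B.apply_symm_apply]
    have hlim : Filter.Tendsto (fun k => ρ (φ k) + ρ (φ k) / r * ‖F (φ k) y - G y‖)
        Filter.atTop (nhds (d + d / r * ‖G y - G y‖)) :=
      hρφ.add ((hρφ.div_const r).mul ((hGx y).sub_const _).norm)
    rw [sub_self, norm_zero, mul_zero, add_zero] at hlim
    refine ge_of_tendsto' hlim fun k => ?_
    have h1 := hlow (φ k) (y - (A (φ k)).symm x)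
    have h2 : F (φ k) (y - (A (φ k)).symm x) = F (φ k) y - G y := by
      rw [map_sub, hFA (φ k) ((A (φ k)).symm x), LinearEquiv.apply_symm_apply, hGy]
    rw [h2] at h1
    have h3 := hA2 (φ k) x hx
    have h4 := norm_le_norm_add_norm_sub' y ((A (φ k)).symm x)
    linarith

end Sandwich

/-! ### Transfer back to `K` and conclusion. -/

section Main

variable {n : ℕ} {K : Set (EuclideanSpace ℝ (Fin n))}

/-- An affine position of `K` in which the distance ellipsoids are balls. -/
theorem IsSymmetricConvexBody.exists_isDistancePosition (hn : 1 ≤ n)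
    (hK : IsSymmetricConvexBody K) :
    ∃ (c : EuclideanSpace ℝ (Fin n))
      (A : EuclideanSpace ℝ (Fin n) ≃ₗ[ℝ] EuclideanSpace ℝ (Fin n)),
      IsDistancePosition ((fun x => c + A x) ⁻¹' K) (banachMazurDist K (unitBall n)) := by
  obtain ⟨⟨hcomp, hconv, p, hp⟩, c, hc⟩ := hK
  set L := (fun x => c + x) ⁻¹' K with hL
  have hmem : ∀ x, x ∈ L ↔ c + x ∈ K := fun x => Iff.rfl
  have hneg : ∀ x ∈ L, -x ∈ L := by
    intro x hx
    have := hc _ hx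
    rw [hmem]
    convert this using 1
    module
  have hLconv : Convex ℝ L := hconv.translate_preimage_right c
  have hLcomp : IsCompact L := (Homeomorph.addLeft c).isCompact_preimage.2 hcomp
  obtain ⟨r, hr, hball⟩ : ∃ r > 0, ∀ x, ‖x‖ ≤ r → x ∈ L := by
    obtain ⟨ε, hε, hball⟩ := Metric.mem_nhds_iff.1 (mem_interior_iff_mem_nhds.1 hp)
    refine ⟨ε / 2, half_pos hε, fun x hx => ?_⟩
    have h1 : p + x ∈ K := hball (by rw [mem_ball_iff_norm, add_sub_cancel_left]; linarith)
    have h2 : p - x ∈ K := hball (by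
      rw [mem_ball_iff_norm, sub_sub_cancel_left, norm_neg]; linarith)
    -- The midpoint of `p + x` and the reflection of `p - x` is `c + x`: a ball at `p` yields one at
    -- `c`.
    have h3 := hconv h1 (hc _ h2) (by norm_num : (0 : ℝ) ≤ 1 / 2) (by norm_num : (0 : ℝ) ≤ 1 / 2)
      (by norm_num)
    rw [hmem]
    convert h3 using 1
    module
  have hd : banachMazurDist K (unitBall n) = sInf {ρ : ℝ | 0 < ρ ∧ IsSandwichRatio L ρ} := by
    rw [banachMazurDist]
    congr 1
    ext ρ
    exact and_congr_right fun hρ => exists_map_vadd_iff_isSandwichRatio hconv hc hρ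
  obtain ⟨hpos, A, hA1, hA2⟩ := isSandwichRatio_sInf hn hLcomp hr hball
  rw [← hd] at hpos hA2
  refine ⟨c, A, IsSandwichBound.preimage ⟨hLcomp, hLconv, hneg, hpos, fun T ρ hρ h1 h2 => ?_⟩
    A hA1 hA2⟩
  rw [hd]
  exact csInf_le ⟨0, fun ρ hρ => hρ.1.le⟩ ⟨hρ, T, h1, h2⟩

variable {c : EuclideanSpace ℝ (Fin n)}
  {A : EuclideanSpace ℝ (Fin n) ≃ₗ[ℝ] EuclideanSpace ℝ (Fin n)}

theorem add_map_mem_preimage_of_ellipsoid_subset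
    {B : EuclideanSpace ℝ (Fin n) ≃ₗ[ℝ] EuclideanSpace ℝ (Fin n)} {p : EuclideanSpace ℝ (Fin n)}
    (h : ellipsoid B p ⊆ K) (b : EuclideanSpace ℝ (Fin n)) (hb : ‖b‖ ≤ 1) :
    A.symm (p - c) + (B.trans A.symm) b ∈ (fun x => c + A x) ⁻¹' K := by
  have := h (add_map_mem_ellipsoid hb)
  rw [Set.mem_preimage]
  convert this using 1
  rw [LinearEquiv.trans_apply, map_add, A.apply_symm_apply, A.apply_symm_apply]
  abel

theorem symm_trans_sub (B : EuclideanSpace ℝ (Fin n) ≃ₗ[ℝ] EuclideanSpace ℝ (Fin n))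
    (p x : EuclideanSpace ℝ (Fin n)) :
    (B.trans A.symm).symm (x - A.symm (p - c)) = B.symm (c + A x - p) := by
  rw [LinearEquiv.symm_trans_apply, LinearEquiv.symm_symm, map_sub, LinearEquiv.apply_symm_apply]
  congr 1
  abel

theorem ellipsoid_eq_scale {B : EuclideanSpace ℝ (Fin n) ≃ₗ[ℝ] EuclideanSpace ℝ (Fin n)} {r : ℝ}
    (hr : 0 < r) (h : ∀ x, ‖(B.trans A.symm) x‖ = r * ‖x‖) :
    ellipsoid B c = ellipsoid (A.scale hr.ne') c := by
  ext x
  rw [mem_ellipsoid, mem_ellipsoid_scale hr]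
  have := h (B.symm (x - c))
  rw [LinearEquiv.trans_apply, LinearEquiv.apply_symm_apply] at this
  rw [this, mul_le_iff_le_one_right hr]

theorem ellipsoid_eq {B : EuclideanSpace ℝ (Fin n) ≃ₗ[ℝ] EuclideanSpace ℝ (Fin n)}
    (h : ∀ x, ‖(B.trans A.symm) x‖ = ‖x‖) : ellipsoid B c = ellipsoid A c := by
  ext x
  rw [mem_ellipsoid, mem_ellipsoid]
  have := h (B.symm (x - c))
  rw [LinearEquiv.trans_apply, LinearEquiv.apply_symm_apply] at this
  rw [this]

theorem IsDistancePosition.isDistanceEllipsoidPair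
    (h : IsDistancePosition ((fun x => c + A x) ⁻¹' K) (banachMazurDist K (unitBall n))) :
    IsDistanceEllipsoidPair K (ellipsoid A c) (ellipsoid (A.scale h.pos.ne') c) where
  isEllipsoid_inner := isEllipsoid_ellipsoid
  isEllipsoid_outer := isEllipsoid_ellipsoid
  homothetic := ⟨c - banachMazurDist K (unitBall n) • c, by
    rw [vadd_smul_ellipsoid h.pos, sub_add_cancel]⟩
  inner_subset := by
    rintro _ ⟨b, hb, rfl⟩
    exact h.mem_of_norm_le b (mem_unitBall.1 hb)
  subset_outer x hx := by
    rw [mem_ellipsoid_scale h.pos]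
    exact h.norm_le _ (by simpa using hx)

theorem IsDistancePosition.eq_of_isDistanceEllipsoidPair
    (h : IsDistancePosition ((fun x => c + A x) ⁻¹' K) (banachMazurDist K (unitBall n)))
    (hn : (n : ℝ) - 1 < banachMazurDist K (unitBall n) ^ 2 ∨ banachMazurDist K (unitBall n) ≤ 1)
    {E₁ E₂ : Set (EuclideanSpace ℝ (Fin n))} (hE : IsDistanceEllipsoidPair K E₁ E₂) :
    E₁ = ellipsoid A c ∧ E₂ = ellipsoid (A.scale h.pos.ne') c := by
  obtain ⟨B, p, rfl⟩ := hE.isEllipsoid_inner.exists_eq_ellipsoid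
  obtain ⟨v, rfl⟩ := hE.homothetic
  have hout := hE.subset_outer
  rw [vadd_smul_ellipsoid h.pos] at hout ⊢
  set q := v + banachMazurDist K (unitBall n) • p with hq
  obtain ⟨h1, h2, h3⟩ := h.sandwich_unique hn (A := B.trans A.symm) (a₁ := A.symm (p - c))
    (a₂ := A.symm (q - c)) (add_map_mem_preimage_of_ellipsoid_subset hE.inner_subset)
    (fun x hx => by
      rw [symm_trans_sub]
      exact (mem_ellipsoid_scale h.pos).1 (hout hx))
  rw [LinearEquiv.map_eq_zero_iff, sub_eq_zero] at h1 h2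
  refine ⟨by rw [h1, ellipsoid_eq h3], ?_⟩
  rw [h2]
  refine (ellipsoid_eq_scale (B := B.scale h.pos.ne') h.pos fun x => ?_)
  rw [LinearEquiv.trans_apply, LinearEquiv.scale_apply, map_smul, norm_smul,
    Real.norm_of_nonneg h.pos.le, ← h3 x]
  rfl

theorem IsDistancePosition.isJohnEllipsoid
    (h : IsDistancePosition ((fun x => c + A x) ⁻¹' K) (banachMazurDist K (unitBall n)))
    (hd : banachMazurDist K (unitBall n) ^ 2 = n) : IsJohnEllipsoid K (ellipsoid A c) where
  isEllipsoid := isEllipsoid_ellipsoid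
  subset := h.isDistanceEllipsoidPair.inner_subset
  volume_lt F hF hFK hne := by
    obtain ⟨B, p, rfl⟩ := hF.exists_eq_ellipsoid
    rcases h.eq_or_abs_det_lt_one hd (A := B.trans A.symm) (a := A.symm (p - c))
      (add_map_mem_preimage_of_ellipsoid_subset hFK) with ⟨h1, h2⟩ | hlt
    · rw [LinearEquiv.map_eq_zero_iff, sub_eq_zero] at h1
      exact absurd (by rw [h1, ellipsoid_eq h2]) hne
    · refine volume_ellipsoid_lt ?_
      have hB : B.toLinearMap = A.toLinearMap ∘ₗ (B.trans A.symm).toLinearMap := by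
        ext x; simp
      rw [hB, LinearMap.det_comp, abs_mul]
      exact mul_lt_of_lt_one_right (abs_pos.2 (LinearEquiv.isUnit_det' A).ne_zero) hlt

theorem IsDistancePosition.isLoewnerEllipsoid
    (h : IsDistancePosition ((fun x => c + A x) ⁻¹' K) (banachMazurDist K (unitBall n)))
    (hd : banachMazurDist K (unitBall n) ^ 2 = n) :
    IsLoewnerEllipsoid K (ellipsoid (A.scale h.pos.ne') c) where
  isEllipsoid := isEllipsoid_ellipsoid
  subset := h.isDistanceEllipsoidPair.subset_outer
  lt_volume F hF hFK hne := by
    obtain ⟨B, p, rfl⟩ := hF.exists_eq_ellipsoid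
    rcases h.eq_or_lt_abs_det hd (A := B.trans A.symm) (a := A.symm (p - c))
      (fun x hx => by rw [symm_trans_sub]; exact mem_ellipsoid.1 (hFK hx)) with ⟨h1, h2⟩ | hlt
    · rw [LinearEquiv.map_eq_zero_iff, sub_eq_zero] at h1
      exact absurd (by rw [h1, ellipsoid_eq_scale h.pos h2]) hne
    · refine volume_ellipsoid_lt ?_
      have hB : B.toLinearMap = A.toLinearMap ∘ₗ (B.trans A.symm).toLinearMap := by
        ext x; simp
      have hS : (A.scale h.pos.ne').toLinearMap =
          banachMazurDist K (unitBall n) • A.toLinearMap := rfl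
      rw [hB, LinearMap.det_comp, abs_mul, hS, LinearMap.det_smul, finrank_euclideanSpace_fin,
        abs_mul, abs_of_nonneg (pow_nonneg h.pos.le n), mul_comm]
      exact mul_lt_mul_of_pos_left hlt (abs_pos.2 (LinearEquiv.isUnit_det' A).ne_zero)

theorem IsDistancePosition.hasUniqueDistanceEllipsoidPair
    (h : IsDistancePosition ((fun x => c + A x) ⁻¹' K) (banachMazurDist K (unitBall n)))
    (hn : (n : ℝ) - 1 < banachMazurDist K (unitBall n) ^ 2 ∨
      banachMazurDist K (unitBall n) ≤ 1) : HasUniqueDistanceEllipsoidPair K := by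
  refine ⟨(ellipsoid A c, ellipsoid (A.scale h.pos.ne') c), h.isDistanceEllipsoidPair, ?_⟩
  rintro ⟨E₁, E₂⟩ hE
  obtain ⟨h1, h2⟩ := h.eq_of_isDistanceEllipsoidPair hn hE
  exact Prod.ext h1 h2

end Main

theorem corollary2p11 (n : ℕ) (hn : 1 ≤ n) (K : Set (EuclideanSpace ℝ (Fin n)))
    (hK : IsSymmetricConvexBody K) :
    (Real.sqrt ((n : ℝ) - 1) < banachMazurDist K (unitBall n) →
      HasUniqueDistanceEllipsoidPair K) ∧
    (banachMazurDist K (unitBall n) = Real.sqrt (n : ℝ) →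
      ∀ E₁ E₂ : Set (EuclideanSpace ℝ (Fin n)), IsDistanceEllipsoidPair K E₁ E₂ →
        IsJohnEllipsoid K E₁ ∧ IsLoewnerEllipsoid K E₂) ∧
    (n = 2 → HasUniqueDistanceEllipsoidPair K) := by
  obtain ⟨c, A, h⟩ := hK.exists_isDistancePosition hn
  refine ⟨fun hd => ?_, fun hd E₁ E₂ hE => ?_, fun h2 => ?_⟩
  · exact h.hasUniqueDistanceEllipsoidPair (Or.inl (Real.lt_sq_of_sqrt_lt hd))
  · have hd2 : banachMazurDist K (unitBall n) ^ 2 = n := by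
      rw [hd, Real.sq_sqrt (Nat.cast_nonneg n)]
    obtain ⟨rfl, rfl⟩ := h.eq_of_isDistanceEllipsoidPair (Or.inl (by rw [hd2]; linarith)) hE
    exact ⟨h.isJohnEllipsoid hd2, h.isLoewnerEllipsoid hd2⟩
  · refine h.hasUniqueDistanceEllipsoidPair ?_
    rcases le_or_gt (banachMazurDist K (unitBall n)) 1 with h1 | h1
    · exact Or.inr h1
    · left
      have : (n : ℝ) = 2 := by exact_mod_cast h2
      rw [this]
      nlinarith
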